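/- Let $(F,g_F)$ be a connected smooth Riemannian manifold of dimension $n-1\ge 2$, and let $\overline M=\mathbb R\times F$ carry the Lorentzian product metric $\overline g=-dt^2+g_F$ and the time orientation given by $\partial_t$. Let $\psi:M^k\to\overline M$ ($k\ge 1$) be a smooth spacelike immersion of a connected manifold $M$, i.e. the induced metric $g=\psi^*\overline g$ is Riemannian. Let $\mathrm{II}(X,Y)=-(\overline\nabla_XY)^\perp$ be its second fundamental form and $\overrightarrow H=\frac1k\,\mathrm{trace}_g\,\mathrm{II}$ its mean curvature vector, and let $\tau$ be its height function, the $\mathbb R$-component of $\psi$. The immersion is called weakly future (past) trapped if $\overrightarrow H$ is causal (nonzero, with $\overline g(\overrightarrow H,\overrightarrow H)\le 0$) and future (past) pointing at every point of $M$, weakly trapped if it is weakly future trapped or weakly past trapped, and extremal if $\overrightarrow H=0$ everywhere. Suppose that $(M,g)$ is parabolic, i.e. every $C^2$ function $u$ on $M$ which is bounded from below and satisfies $\Delta_g u\le 0$ is constant (closed manifolds $M$ are allowed). Then: 1. If $\psi(M)$ is contained in a slab, i.e. $a\le\tau\le b$ for some $a,b\in\mathbb R$, then $\psi$ is not weakly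 trapped. 2. $\psi$ is extremal and bounded away from future or past infinity (i.e. $\sup_M\tau<+\infty$ or $\inf_M\tau>-\infty$) if and only if $\psi$ is a minimal submanifold of a spacelike slice, i.e. there is $t_0\in\mathbb R$ with $\psi(M)\subset\{t_0\}\times F$ and the immersion $\pi_F\circ\psi:M\to(F,g_F)$ has zero mean curvature vector. -/

import Mathlib

open scoped Manifold ContDiff

noncomputable section

namespace LorentzProduct

section General

variable {E : Type*} [NormedAddCommGroup E] [NormedSpace ℝ E]
  {H : Type*} [TopologicalSpace H]
  {E' : Type*} [NormedAddCommGroup E'] [NormedSpace ℝ E']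
  {H' : Type*} [TopologicalSpace H']

/-- A field of bilinear forms on the tangent spaces of the manifold `N`.  In Mathlib the tangent
space `TangentSpace J x` at any point `x` is by definition the model vector space `E'`, identified
with `T_x N` through the preferred chart at `x`. -/
abbrev FormField (_J : ModelWithCorners ℝ E' H') (N : Type*) [TopologicalSpace N]
    [ChartedSpace H' N] : Type _ := N → E' →L[ℝ] E' →L[ℝ] ℝ

/-- The differential of `ψ : M → N` at `p`, as a linear map `T_p M → T_{ψ p} N`. -/
def differential (I : ModelWithCorners ℝ E H) (J : ModelWithCorners ℝ E' H')
    {M N : Type*} [TopologicalSpace M] [ChartedSpace H M] [TopologicalSpace N] [ChartedSpace H' N]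
    (ψ : M → N) (p : M) : E →L[ℝ] E' := mfderiv I J ψ p

/-- The pullback `ψ^* g` of a field of bilinear forms. -/
def pullback (I : ModelWithCorners ℝ E H) (J : ModelWithCorners ℝ E' H')
    {M N : Type*} [TopologicalSpace M] [ChartedSpace H M] [TopologicalSpace N] [ChartedSpace H' N]
    (ψ : M → N) (g : FormField J N) : FormField I M :=
  fun p => (g (ψ p)).bilinearComp (differential I J ψ p) (differential I J ψ p)

/-- The coordinate expression of `g` in the preferred chart at `x₀`: at the point with coordinates
`y` it is the bilinear form whose value on `u, v` is `g (dα u, dα v)`, where `α` is the inverse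
chart, i.e. the form with components `g_{ij}(y)`. -/
def chartForm (J : ModelWithCorners ℝ E' H') {N : Type*} [TopologicalSpace N] [ChartedSpace H' N]
    (g : FormField J N) (x₀ : N) : E' → E' →L[ℝ] E' →L[ℝ] ℝ :=
  pullback 𝓘(ℝ, E') J (extChartAt J x₀).symm g

/-- The Christoffel symbols of the second kind of `g`, in the preferred chart at `x₀`, at the point
with coordinates `y`: the vector `Γ(u, v)` is characterised by
`2 g(Γ(u, v), w) = ∂_u g(v, w) + ∂_v g(u, w) - ∂_w g(u, v)` for all `w`. -/
def christoffel (J : ModelWithCorners ℝ E' H') {N : Type*} [TopologicalSpace N] [ChartedSpace H' N]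
    (g : FormField J N) (x₀ : N) (y u v : E') : E' :=
  let G : E' → E' →L[ℝ] E' →L[ℝ] ℝ := chartForm J g x₀
  let DG : E' →L[ℝ] E' →L[ℝ] E' →L[ℝ] ℝ := fderiv ℝ G y
  (G y).inverse ((1 / 2 : ℝ) • (DG u v + DG v u - (DG.flip u).flip v))

/-- The Levi-Civita covariant derivative `∇_u v` of `N` along `ψ : M → N` at `p`, where `u, v` also
denote the coordinate vector fields on `M` with constant components `u, v` in the preferred chart
at `p`, and `v` is pushed forward to a vector field along `ψ`.  In coordinates it is
`∂_u ∂_v ψ + Γ(∂_u ψ, ∂_v ψ)`. -/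
def covDerivAlong (I : ModelWithCorners ℝ E H) (J : ModelWithCorners ℝ E' H')
    {M N : Type*} [TopologicalSpace M] [ChartedSpace H M] [TopologicalSpace N] [ChartedSpace H' N]
    (g : FormField J N) (ψ : M → N) (p : M) (u v : E) : E' :=
  let ψc : E → E' := writtenInExtChartAt I J p ψ
  let y : E := extChartAt I p p
  fderiv ℝ (fderiv ℝ ψc) y u v +
    christoffel J g (ψ p) (ψc y) (fderiv ℝ ψc y u) (fderiv ℝ ψc y v)

/-- The tangential component, as an element of `T_p M`, of a vector `a` of `T_{ψ p} N`: the vector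
`w` with `g(dψ w, dψ z) = g(a, dψ z)` for all `z` in `T_p M`. -/
def tangentPart (I : ModelWithCorners ℝ E H) (J : ModelWithCorners ℝ E' H')
    {M N : Type*} [TopologicalSpace M] [ChartedSpace H M] [TopologicalSpace N] [ChartedSpace H' N]
    (g : FormField J N) (ψ : M → N) (p : M) (a : E') : E :=
  (pullback I J ψ g p).inverse ((g (ψ p) a).comp (differential I J ψ p))

/-- The normal component `a^⊥` of a vector `a` of `T_{ψ p} N`. -/
def normalPart (I : ModelWithCorners ℝ E H) (J : ModelWithCorners ℝ E' H')
    {M N : Type*} [TopologicalSpace M] [ChartedSpace H M] [TopologicalSpace N] [ChartedSpace H' N]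
    (g : FormField J N) (ψ : M → N) (p : M) (a : E') : E' :=
  a - differential I J ψ p (tangentPart I J g ψ p a)

/-- The second fundamental form, with the sign convention `II(u, v) = -(∇_u v)^⊥`. -/
def secondFundamentalForm (I : ModelWithCorners ℝ E H) (J : ModelWithCorners ℝ E' H')
    {M N : Type*} [TopologicalSpace M] [ChartedSpace H M] [TopologicalSpace N] [ChartedSpace H' N]
    (g : FormField J N) (ψ : M → N) (p : M) (u v : E) : E' :=
  -normalPart I J g ψ p (covDerivAlong I J g ψ p u v)

/-- The Hessian `∇²u` of a function with respect to `g`, at `p`; in coordinates it is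
`∂_v ∂_w u - du(Γ(v, w))`. -/
def hessian (I : ModelWithCorners ℝ E H) {M : Type*} [TopologicalSpace M] [ChartedSpace H M]
    (g : FormField I M) (u : M → ℝ) (p : M) (v w : E) : ℝ :=
  let uc : E → ℝ := u ∘ (extChartAt I p).symm
  let y : E := extChartAt I p p
  fderiv ℝ (fderiv ℝ uc) y v w - fderiv ℝ uc y (christoffel I g p y v w)

end General

/-- The trace `∑ g^{ij} B(e_i, e_j)` of a (vector-valued) bilinear map `B` with respect to the
bilinear form `g`. -/
def metricTrace {k : ℕ} {W : Type*} [AddCommGroup W] [Module ℝ W]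
    (g : EuclideanSpace ℝ (Fin k) →L[ℝ] EuclideanSpace ℝ (Fin k) →L[ℝ] ℝ)
    (B : EuclideanSpace ℝ (Fin k) → EuclideanSpace ℝ (Fin k) → W) : W :=
  let e : Fin k → EuclideanSpace ℝ (Fin k) := fun i => EuclideanSpace.single i 1
  let gram : Matrix (Fin k) (Fin k) ℝ := Matrix.of fun i j => g (e i) (e j)
  ∑ i, ∑ j, gram⁻¹ i j • B (e i) (e j)

section Submanifold

variable (k : ℕ) {M : Type*} [TopologicalSpace M] [ChartedSpace (EuclideanSpace ℝ (Fin k)) M]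

/-- The Laplace-Beltrami operator `Δ_g u = tr_g ∇²u`. -/
def laplacian (g : FormField (𝓡 k) M) (u : M → ℝ) (p : M) : ℝ :=
  metricTrace (g p) (hessian (𝓡 k) g u p)

/-- `(M, g)` is parabolic: every superharmonic function (of class `C²`, with `Δ_g u ≤ 0`) bounded
from below is constant.  Closed manifolds are included. -/
def IsParabolic (g : FormField (𝓡 k) M) : Prop :=
  ∀ u : M → ℝ, ContMDiff (𝓡 k) 𝓘(ℝ, ℝ) 2 u → (∀ p, laplacian k g u p ≤ 0) →
    BddBelow (Set.range u) → ∃ c : ℝ, ∀ p, u p = c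

/-- The mean curvature vector `(1 / k) trace II` of `ψ : M → (N, g)`, the trace being taken with
respect to the induced metric. -/
def meanCurvature {E' : Type*} [NormedAddCommGroup E'] [NormedSpace ℝ E']
    {H' : Type*} [TopologicalSpace H'] (J : ModelWithCorners ℝ E' H')
    {N : Type*} [TopologicalSpace N] [ChartedSpace H' N]
    (g : FormField J N) (ψ : M → N) (p : M) : E' :=
  (1 / (k : ℝ)) •
    metricTrace (pullback (𝓡 k) J ψ g p) (secondFundamentalForm (𝓡 k) J g ψ p)

end Submanifold

section Product

variable {m : ℕ} {F : Type*} [TopologicalSpace F] [ChartedSpace (EuclideanSpace ℝ (Fin m)) F]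
  [IsManifold (𝓡 m) ∞ F]

/-- A smooth Riemannian metric on `F`. -/
abbrev RiemannianMetricOn (m : ℕ) (F : Type*) [TopologicalSpace F]
    [ChartedSpace (EuclideanSpace ℝ (Fin m)) F] [IsManifold (𝓡 m) ∞ F] : Type _ :=
  Bundle.ContMDiffRiemannianMetric (𝓡 m) ∞ (EuclideanSpace ℝ (Fin m))
    (TangentSpace (𝓡 m) : F → Type _)

/-- The Riemannian metric of `F` as a field of bilinear forms. -/
def fiberMetric (gF : RiemannianMetricOn m F) : FormField (𝓡 m) F := fun x => gF.inner x

/-- The model of the product manifold `ℝ × F`. -/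
abbrev prodModel (m : ℕ) :
    ModelWithCorners ℝ (ℝ × EuclideanSpace ℝ (Fin m)) (ModelProd ℝ (EuclideanSpace ℝ (Fin m))) :=
  𝓘(ℝ, ℝ).prod (𝓡 m)

/-- The metric `dt²` of the real line. -/
def lineMetric : FormField 𝓘(ℝ, ℝ) ℝ := fun _ => ContinuousLinearMap.mul ℝ ℝ

/-- The Lorentzian product metric `-π_ℝ^*(dt²) + π_F^*(g_F)` on `ℝ × F`. -/
def lorentzMetric (gF : RiemannianMetricOn m F) : FormField (prodModel m) (ℝ × F) :=
  fun x => -pullback (prodModel m) 𝓘(ℝ, ℝ) Prod.fst lineMetric x +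
    pullback (prodModel m) (𝓡 m) Prod.snd (fiberMetric gF) x

/-- The vector `∂_t`, at any point of `ℝ × F`; it defines the time orientation. -/
def timeVector (m : ℕ) : ℝ × EuclideanSpace ℝ (Fin m) := (1, 0)

/-- A tangent vector at `x` is causal (timelike or lightlike). -/
def IsCausal (gF : RiemannianMetricOn m F) (x : ℝ × F) (v : ℝ × EuclideanSpace ℝ (Fin m)) : Prop :=
  v ≠ 0 ∧ lorentzMetric gF x v v ≤ 0

/-- A causal vector is future pointing when `g(v, ∂_t) < 0`. -/
def IsFutureCausal (gF : RiemannianMetricOn m F) (x : ℝ × F)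
    (v : ℝ × EuclideanSpace ℝ (Fin m)) : Prop :=
  IsCausal gF x v ∧ lorentzMetric gF x v (timeVector m) < 0

/-- A causal vector is past pointing when `g(v, ∂_t) > 0`. -/
def IsPastCausal (gF : RiemannianMetricOn m F) (x : ℝ × F)
    (v : ℝ × EuclideanSpace ℝ (Fin m)) : Prop :=
  IsCausal gF x v ∧ 0 < lorentzMetric gF x v (timeVector m)

variable (k : ℕ) {M : Type*} [TopologicalSpace M] [ChartedSpace (EuclideanSpace ℝ (Fin k)) M]

/-- The metric induced on `M` by `ψ : M → ℝ × F`. -/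
def inducedMetric (gF : RiemannianMetricOn m F) (ψ : M → ℝ × F) : FormField (𝓡 k) M :=
  pullback (𝓡 k) (prodModel m) ψ (lorentzMetric gF)

/-- `ψ` is a smooth spacelike immersion: the induced metric is Riemannian.  (Positive definiteness
already forces the differential to be injective.) -/
structure IsSpacelikeImmersion (gF : RiemannianMetricOn m F) (ψ : M → ℝ × F) : Prop where
  smooth : ContMDiff (𝓡 k) (prodModel m) ∞ ψ
  injective_differential : ∀ p, Function.Injective (differential (𝓡 k) (prodModel m) ψ p)
  posDef : ∀ (p : M) (v : EuclideanSpace ℝ (Fin k)), v ≠ 0 → 0 < inducedMetric k gF ψ p v v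

/-- The mean curvature vector of `ψ` in the Lorentzian product. -/
def meanCurvatureVector (gF : RiemannianMetricOn m F) (ψ : M → ℝ × F) (p : M) :
    ℝ × EuclideanSpace ℝ (Fin m) :=
  meanCurvature k (prodModel m) (lorentzMetric gF) ψ p

/-- Weakly future trapped, or weakly past trapped. -/
def IsWeaklyTrapped (gF : RiemannianMetricOn m F) (ψ : M → ℝ × F) : Prop :=
  (∀ p, IsFutureCausal gF (ψ p) (meanCurvatureVector k gF ψ p)) ∨
    (∀ p, IsPastCausal gF (ψ p) (meanCurvatureVector k gF ψ p))

/-- Extremal: the mean curvature vector vanishes. -/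
def IsExtremal (gF : RiemannianMetricOn m F) (ψ : M → ℝ × F) : Prop :=
  ∀ p, meanCurvatureVector k gF ψ p = 0

/-- `ψ(M)` lies between two spacelike slices. -/
def InSlab {M F : Type*} (ψ : M → ℝ × F) : Prop :=
  ∃ a b : ℝ, ∀ p, a ≤ (ψ p).1 ∧ (ψ p).1 ≤ b

/-- The height function is bounded from above. -/
def BoundedAwayFromFutureInfinity {M F : Type*} (ψ : M → ℝ × F) : Prop :=
  ∃ b : ℝ, ∀ p, (ψ p).1 ≤ b

/-- The height function is bounded from below. -/
def BoundedAwayFromPastInfinity {M F : Type*} (ψ : M → ℝ × F) : Prop :=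
  ∃ a : ℝ, ∀ p, a ≤ (ψ p).1

/-- `ψ` is a minimal submanifold of a spacelike slice: `ψ(M) ⊆ {t₀} × F` for some `t₀`, and the
immersion `π_F ∘ ψ` into the slice, on which the induced metric is `g_F`, has zero mean curvature
vector. -/
def IsMinimalInSlice (gF : RiemannianMetricOn m F) (ψ : M → ℝ × F) : Prop :=
  ∃ t₀ : ℝ, (∀ p, (ψ p).1 = t₀) ∧
    ∀ p, meanCurvature k (𝓡 m) (fiberMetric gF) (fun q => (ψ q).2) p = 0

end Product

end LorentzProduct

end

/-! The argument rests on the identity `Δτ = -k H₀`, where `τ` is the height, `Δ` the Laplacian of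
the induced metric and `H₀` the time component of the mean curvature vector (`laplacian_height`).
Two facts produce it. By the Gauss formula, the tangential part of the ambient covariant derivative
along `ψ` is given by the Christoffel symbols of the induced metric (`tangentPart_covDerivAlong`).
Since `dt²` has constant coefficients, the Christoffel symbols of the product have no time component
(`christoffel_lorentzMetric`). Hence the time component of `(∇_u v)^⊥` is `∂_u ∂_v τ - dτ(Γ(u, v))`,
the Hessian of `τ`; the convention `II = -(∇)^⊥` supplies the sign.

A future (past) pointing mean curvature vector has `H₀ > 0` (`H₀ < 0`), so `τ` is strictly
superharmonic (subharmonic). In a slab, parabolicity makes `τ` constant, so `H₀ = 0`, a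
contradiction. If `ψ` is extremal, then `τ` is harmonic, and a bound on either side makes it
constant. For constant `τ` the time component of the mean curvature vector vanishes and its `F`
component is the mean curvature vector of `π_F ∘ ψ`; this finishes both directions of the
equivalence. -/

namespace LorentzProduct

open scoped Topology
open Filter

/-! ### Nondegenerate bilinear forms and the Koszul identity in a vector space. -/

section Linear

variable {V W : Type*} [NormedAddCommGroup V] [NormedSpace ℝ V] [NormedAddCommGroup W]
  [NormedSpace ℝ W]

/-- A continuous bilinear form is nondegenerate when no nonzero vector is orthogonal to all. -/
def IsNondegenerate (B : V →L[ℝ] V →L[ℝ] ℝ) : Prop := ∀ u, (∀ w, B u w = 0) → u = 0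

theorem IsNondegenerate.of_pos {B : V →L[ℝ] V →L[ℝ] ℝ} (h : ∀ v, v ≠ 0 → 0 < B v v) :
    IsNondegenerate B := fun u hu => by
  by_contra hne
  exact (h u hne).ne' (hu u)

/-- `ContinuousLinearMap.inverse` is zero on maps that are not invertible. This lemma gives
`christoffel` and `tangentPart` their intended meaning: an injective map from `V` to its dual is
bijective by dimension count. -/
theorem IsNondegenerate.isInvertible [FiniteDimensional ℝ V] {B : V →L[ℝ] V →L[ℝ] ℝ}
    (h : IsNondegenerate B) : B.IsInvertible := by
  have hinj : Function.Injective (B : V →ₗ[ℝ] (V →L[ℝ] ℝ)) := by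
    rw [← LinearMap.ker_eq_bot, LinearMap.ker_eq_bot']
    intro u hu
    exact h u fun w => by
      simpa using congrArg (fun L : V →L[ℝ] ℝ => L w) hu
  have hdim : Module.finrank ℝ V = Module.finrank ℝ (V →L[ℝ] ℝ) := by
    rw [← (LinearMap.toContinuousLinearMap (𝕜 := ℝ) (E := V) (F' := ℝ)).finrank_eq]
    exact (Subspace.dual_finrank_eq (K := ℝ) (V := V)).symm
  refine ⟨(LinearEquiv.ofInjectiveOfFinrankEq _ hinj hdim).toContinuousLinearEquiv, ?_⟩
  ext u w
  rfl

theorem IsNondegenerate.apply_inverse [FiniteDimensional ℝ V] {B : V →L[ℝ] V →L[ℝ] ℝ}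
    (h : IsNondegenerate B) (a : V →L[ℝ] ℝ) : B (B.inverse a) = a :=
  (h.isInvertible.inverse_apply_eq.1 rfl).symm

theorem IsNondegenerate.inverse_eq [FiniteDimensional ℝ V] {B : V →L[ℝ] V →L[ℝ] ℝ}
    (h : IsNondegenerate B) {a : V →L[ℝ] ℝ} {u : V} (hu : ∀ w, B u w = a w) : B.inverse a = u :=
  h.isInvertible.inverse_apply_eq.2 (by ext w; exact (hu w).symm)

theorem map_metricTrace {k : ℕ}
    (g : EuclideanSpace ℝ (Fin k) →L[ℝ] EuclideanSpace ℝ (Fin k) →L[ℝ] ℝ)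
    (B : EuclideanSpace ℝ (Fin k) → EuclideanSpace ℝ (Fin k) → V) (L : V →ₗ[ℝ] W) :
    L (metricTrace g B) = metricTrace g fun u v => L (B u v) := by
  simp [metricTrace, map_sum]

/-- A basis of `V` identifies `V →L[ℝ] U` with a finite power of `U`, where differentiability is
componentwise. Metrics can therefore be differentiated through their components `g_{ij}`. -/
theorem differentiableAt_clm_of_apply {U : Type*} [NormedAddCommGroup U] [NormedSpace ℝ U]
    [FiniteDimensional ℝ V] {G : W → V →L[ℝ] U} {y : W}
    (h : ∀ v, DifferentiableAt ℝ (fun z => G z v) y) : DifferentiableAt ℝ G y := by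
  let d := Module.finrank ℝ V
  have hd : d = Module.finrank ℝ (Fin d → ℝ) := (Module.finrank_fin_fun ℝ).symm
  let e₁ := ContinuousLinearEquiv.ofFinrankEq hd
  let e₂ := (e₁.arrowCongr (ContinuousLinearEquiv.refl ℝ U)).trans
    (ContinuousLinearEquiv.piRing (Fin d))
  rw [← e₂.comp_differentiableAt_iff]
  exact differentiableAt_pi.2 fun i => h _

theorem differentiableAt_of_apply₂ [FiniteDimensional ℝ V] {G : W → V →L[ℝ] V →L[ℝ] ℝ} {y : W}
    (h : ∀ u v, DifferentiableAt ℝ (fun z => G z u v) y) : DifferentiableAt ℝ G y :=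
  differentiableAt_clm_of_apply fun u => differentiableAt_clm_of_apply fun v => h u v

/-- The Koszul identities of a pulled back metric: if `G = f^* G'` near `y`, then the covariant
derivative `∂_u ∂_v f + Γ'(∂_u f, ∂_v f)` has the tangential part `Γ(u, v)`. -/
theorem koszul_pullback [FiniteDimensional ℝ V] {G : V → V →L[ℝ] V →L[ℝ] ℝ}
    {G' : W → W →L[ℝ] W →L[ℝ] ℝ} {f : V → W}
    {y : V} (hf : ContDiffAt ℝ 2 f y) (hG' : DifferentiableAt ℝ G' (f y))
    (hsymm : ∀ a b, G' (f y) a b = G' (f y) b a)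
    (hG : G =ᶠ[𝓝 y] fun z => (G' (f z)).bilinearComp (fderiv ℝ f z) (fderiv ℝ f z))
    (u v w : V) :
    fderiv ℝ G y u v w + fderiv ℝ G y v u w - fderiv ℝ G y w u v =
      fderiv ℝ G' (f y) (fderiv ℝ f y u) (fderiv ℝ f y v) (fderiv ℝ f y w) +
      fderiv ℝ G' (f y) (fderiv ℝ f y v) (fderiv ℝ f y u) (fderiv ℝ f y w) -
      fderiv ℝ G' (f y) (fderiv ℝ f y w) (fderiv ℝ f y u) (fderiv ℝ f y v) +
      2 * G' (f y) (fderiv ℝ (fderiv ℝ f) y u v) (fderiv ℝ f y w) := by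
  have hdf : DifferentiableAt ℝ (fderiv ℝ f) y :=
    (hf.fderiv_right (m := 1) (by norm_num)).differentiableAt (by norm_num)
  have hfy : DifferentiableAt ℝ f y := hf.differentiableAt (by norm_num)
  have hG'f : HasFDerivAt (fun z => G' (f z)) ((fderiv ℝ G' (f y)).comp (fderiv ℝ f y)) y :=
    HasFDerivAt.comp (g := G') y hG'.hasFDerivAt hfy.hasFDerivAt
  -- Product rule for `G'(f)(∂_b f, ∂_c f)` in the direction `a`.
  have key : ∀ a b c : V, fderiv ℝ G y a b c =
      fderiv ℝ G' (f y) (fderiv ℝ f y a) (fderiv ℝ f y b) (fderiv ℝ f y c) +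
      G' (f y) (fderiv ℝ (fderiv ℝ f) y a b) (fderiv ℝ f y c) +
      G' (f y) (fderiv ℝ f y b) (fderiv ℝ (fderiv ℝ f) y a c) := by
    intro a b c
    have h1 : ∀ b : V, HasFDerivAt (fun z => fderiv ℝ f z b)
        ((fderiv ℝ (fderiv ℝ f) y).flip b) y := fun b => by
      convert! hdf.hasFDerivAt.clm_apply (hasFDerivAt_const b y) using 1
      ext x; simp
    have h2 := (hG'f.clm_apply (h1 b)).clm_apply (h1 c)
    have hGd : DifferentiableAt ℝ G y := by
      refine DifferentiableAt.congr_of_eventuallyEq ?_ hG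
      exact differentiableAt_of_apply₂ fun a b =>
        ((hG'f.clm_apply (h1 a)).clm_apply (h1 b)).differentiableAt
    have h3 : HasFDerivAt (fun z => G z b c) ((((fderiv ℝ G y).flip b)).flip c) y := by
      convert! (hGd.hasFDerivAt.clm_apply (hasFDerivAt_const b y)).clm_apply
        (hasFDerivAt_const c y) using 1
      ext x; simp
    have h4 := (h3.congr_of_eventuallyEq (f₁ := fun z => G' (f z) (fderiv ℝ f z b) (fderiv ℝ f z c))
      (by filter_upwards [hG] with z hz; simp [hz])).unique h2
    have := congrArg (fun L : V →L[ℝ] ℝ => L a) h4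
    simp at this
    rw [this]; ring
  have hs : ∀ a b, fderiv ℝ (fderiv ℝ f) y a b = fderiv ℝ (fderiv ℝ f) y b a := fun a b =>
    (hf.isSymmSndFDerivAt (by simp)).eq a b
  -- Of the six second-derivative terms, those with `∂_u ∂_w f` and `∂_v ∂_w f` cancel in pairs; the
  -- two with `∂_u ∂_v f` add up.
  rw [key, key, key, hs v u, hs w u, hs w v, hsymm (fderiv ℝ f y v), hsymm (fderiv ℝ f y u)]
  ring

end Linear

/-! ### Metrics in charts, Christoffel symbols and the Gauss formula. -/

section Charts

variable {E : Type*} [NormedAddCommGroup E] [NormedSpace ℝ E]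
  {H : Type*} [TopologicalSpace H] {I : ModelWithCorners ℝ E H}
  {E' : Type*} [NormedAddCommGroup E'] [NormedSpace ℝ E']
  {H' : Type*} [TopologicalSpace H'] {J : ModelWithCorners ℝ E' H'}
  {E'' : Type*} [NormedAddCommGroup E''] [NormedSpace ℝ E'']
  {H'' : Type*} [TopologicalSpace H''] {K : ModelWithCorners ℝ E'' H''}
  {M : Type*} [TopologicalSpace M] [ChartedSpace H M]
  {N : Type*} [TopologicalSpace N] [ChartedSpace H' N]
  {P : Type*} [TopologicalSpace P] [ChartedSpace H'' P]

theorem differential_comp {f : N → P} {ψ : M → N} {p : M} (hf : MDifferentiableAt J K f (ψ p))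
    (hψ : MDifferentiableAt I J ψ p) :
    differential I K (f ∘ ψ) p = (differential J K f (ψ p)).comp (differential I J ψ p) :=
  mfderiv_comp p hf hψ

theorem pullback_comp {f : N → P} {ψ : M → N} {p : M} (g : FormField K P)
    (hf : MDifferentiableAt J K f (ψ p)) (hψ : MDifferentiableAt I J ψ p) :
    pullback I K (f ∘ ψ) g p = pullback I J ψ (pullback J K f g) p := by
  ext u v
  simp [pullback, differential_comp hf hψ]

theorem differential_of_boundaryless [I.Boundaryless] {ψ : M → N} {p : M}
    (hψ : MDifferentiableAt I J ψ p) :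
    differential I J ψ p = fderiv ℝ (writtenInExtChartAt I J p ψ) (extChartAt I p p) := by
  simp [differential, mfderiv, hψ, I.range_eq_univ]

theorem mdifferentiableAt_extChartAt_symm [IsManifold J 1 N] [J.Boundaryless] {x : N} {y : E'}
    (hy : y ∈ (extChartAt J x).target) :
    MDifferentiableAt 𝓘(ℝ, E') J (extChartAt J x).symm y := by
  have h := mdifferentiableWithinAt_extChartAt_symm hy
  rwa [J.range_eq_univ, mdifferentiableWithinAt_univ] at h

/-- The tangent space at `x` is identified with the model space through this very chart, so at its
base point no coordinate change intervenes. -/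
theorem differential_extChartAt_symm_self [IsManifold J 1 N] [J.Boundaryless] (x : N) :
    differential 𝓘(ℝ, E') J (extChartAt J x).symm (extChartAt J x x) =
      ContinuousLinearMap.id ℝ E' := by
  have h := mfderivWithin_range_extChartAt_symm (I := J) (x := x)
  rwa [J.range_eq_univ, mfderivWithin_univ] at h

theorem chartForm_self [IsManifold J 1 N] [J.Boundaryless] (g : FormField J N) (x : N) :
    chartForm J g x (extChartAt J x x) = g x := by
  rw [chartForm, pullback, differential_extChartAt_symm_self, extChartAt_to_inv]
  rfl

theorem contDiffAt_writtenInExtChartAt [I.Boundaryless] {n : WithTop ℕ∞} {ψ : M → N} {p : M}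
    (hψ : ContMDiffAt I J n ψ p) :
    ContDiffAt ℝ n (writtenInExtChartAt I J p ψ) (extChartAt I p p) := by
  have h := (contMDiffAt_iff.1 hψ).2
  rwa [I.range_eq_univ, contDiffWithinAt_univ] at h

/-- Near the base point, the coordinate expression of a pulled back metric is the pullback of the
coordinate expression of the metric. -/
theorem chartForm_pullback [IsManifold I 1 M] [IsManifold J 1 N] [I.Boundaryless]
    [J.Boundaryless] (g : FormField J N) {ψ : M → N} (hψ : ContMDiff I J 1 ψ) (p : M) :
    ∀ᶠ y in 𝓝 (extChartAt I p p), chartForm I (pullback I J ψ g) p y =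
      (chartForm J g (ψ p) (writtenInExtChartAt I J p ψ y)).bilinearComp
        (fderiv ℝ (writtenInExtChartAt I J p ψ) y) (fderiv ℝ (writtenInExtChartAt I J p ψ) y) := by
  have hcont : ContinuousAt (fun y => ψ ((extChartAt I p).symm y)) (extChartAt I p p) :=
    hψ.continuous.continuousAt.comp (continuousAt_extChartAt_symm p)
  have hsrc : ∀ᶠ y in 𝓝 (extChartAt I p p),
      ψ ((extChartAt I p).symm y) ∈ (extChartAt J (ψ p)).source :=
    hcont.eventually_mem (by simpa using extChartAt_source_mem_nhds (I := J) (ψ p))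
  have hd : ∀ᶠ y in 𝓝 (extChartAt I p p),
      DifferentiableAt ℝ (writtenInExtChartAt I J p ψ) y :=
    ((contDiffAt_writtenInExtChartAt (hψ p)).eventually (by simp)).mono
      fun y hy => hy.differentiableAt (by simp)
  -- Derivatives at `y` are compared, so the chart condition must hold on a neighbourhood of `y`,
  -- not only at `y`.
  filter_upwards [hsrc.eventually_nhds, hd, extChartAt_target_mem_nhds (I := I) p]
    with y hy hdy hty
  have hψd : MDifferentiableAt I J ψ ((extChartAt I p).symm y) :=
    hψ.mdifferentiable (by simp) _
  have hφ := mdifferentiableAt_extChartAt_symm (J := I) hty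
  have hyt : writtenInExtChartAt I J p ψ y ∈ (extChartAt J (ψ p)).target :=
    (extChartAt J (ψ p)).map_source hy.self_of_nhds
  have heq : ψ ∘ (extChartAt I p).symm =ᶠ[𝓝 y]
      (extChartAt J (ψ p)).symm ∘ writtenInExtChartAt I J p ψ := by
    filter_upwards [hy] with z hz
    exact ((extChartAt J (ψ p)).left_inv hz).symm
  have h1 : pullback 𝓘(ℝ, E) J (ψ ∘ (extChartAt I p).symm) g y =
      pullback 𝓘(ℝ, E) J ((extChartAt J (ψ p)).symm ∘ writtenInExtChartAt I J p ψ) g y := by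
    ext u v
    simp only [pullback, differential]
    rw [heq.mfderiv_eq, heq.self_of_nhds]
  rw [pullback_comp (J := I) g hψd hφ, pullback_comp (J := 𝓘(ℝ, E')) g
    (mdifferentiableAt_extChartAt_symm hyt) hdy.mdifferentiableAt] at h1
  rw [chartForm, h1]
  simp only [pullback, chartForm, differential, mfderiv_eq_fderiv]

/-- The Koszul formula for the Christoffel symbols at the base point of the chart. -/
theorem koszul_christoffel [FiniteDimensional ℝ E'] [IsManifold J 1 N] [J.Boundaryless]
    {g : FormField J N} {x : N} (hg : IsNondegenerate (g x)) (u v w : E') :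
    2 * g x (christoffel J g x (extChartAt J x x) u v) w =
      fderiv ℝ (chartForm J g x) (extChartAt J x x) u v w +
      fderiv ℝ (chartForm J g x) (extChartAt J x x) v u w -
      fderiv ℝ (chartForm J g x) (extChartAt J x x) w u v := by
  simp only [christoffel, chartForm_self, hg.apply_inverse]
  simp

theorem christoffel_eq [FiniteDimensional ℝ E'] [IsManifold J 1 N] [J.Boundaryless]
    {g : FormField J N} {x : N} (hg : IsNondegenerate (g x)) {u v c : E'}
    (h : ∀ w, 2 * g x c w =
      fderiv ℝ (chartForm J g x) (extChartAt J x x) u v w +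
      fderiv ℝ (chartForm J g x) (extChartAt J x x) v u w -
      fderiv ℝ (chartForm J g x) (extChartAt J x x) w u v) :
    christoffel J g x (extChartAt J x x) u v = c := by
  refine sub_eq_zero.1 (hg _ fun w => ?_)
  have h1 := koszul_christoffel hg u v w
  have h2 := h w
  simp only [map_sub, sub_apply]
  linarith

/-- The Gauss formula: the tangential part of the covariant derivative along an immersion is the
covariant derivative of the induced metric. -/
theorem tangentPart_covDerivAlong [FiniteDimensional ℝ E] [FiniteDimensional ℝ E']
    [IsManifold I 1 M] [IsManifold J 1 N] [I.Boundaryless] [J.Boundaryless]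
    {g : FormField J N} {ψ : M → N} (hψ : ContMDiff I J 2 ψ) (p : M)
    (hsymm : ∀ a b, g (ψ p) a b = g (ψ p) b a) (hg : IsNondegenerate (g (ψ p)))
    (hdiff : DifferentiableAt ℝ (chartForm J g (ψ p)) (extChartAt J (ψ p) (ψ p)))
    (hpull : IsNondegenerate (pullback I J ψ g p)) (u v : E) :
    tangentPart I J g ψ p (covDerivAlong I J g ψ p u v) =
      christoffel I (pullback I J ψ g) p (extChartAt I p p) u v := by
  have hbase : writtenInExtChartAt I J p ψ (extChartAt I p p) = extChartAt J (ψ p) (ψ p) := by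
    simp [writtenInExtChartAt]
  have hdψ := differential_of_boundaryless (hψ.mdifferentiable (by simp) p)
  refine hpull.inverse_eq fun w => ?_
  have h1 := koszul_christoffel hpull u v w
  have h2 := koszul_pullback (G' := chartForm J g (ψ p)) (contDiffAt_writtenInExtChartAt (hψ p))
    (by rwa [hbase]) (by rw [hbase, chartForm_self]; exact hsymm)
    (chartForm_pullback g (hψ.of_le (by norm_num)) p) u v w
  -- The ambient metric derivatives form the Koszul expression of the ambient Christoffel symbols.
  -- With the second-derivative term they give `2 g(∇_u v, dψ w)`, while the left side is the Koszul
  -- expression of the induced metric.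
  rw [hbase, chartForm_self, ← koszul_christoffel hg, ← h1] at h2
  simp only [covDerivAlong, hbase, ContinuousLinearMap.comp_apply, hdψ, map_add, add_apply]
  linarith

end Charts

/-! ### Regularity of the Riemannian metric in charts. -/

section FiberMetric

variable {m : ℕ} {F : Type*} [TopologicalSpace F] [ChartedSpace (EuclideanSpace ℝ (Fin m)) F]
  [IsManifold (𝓡 m) ∞ F] (gF : RiemannianMetricOn m F)

theorem fiberMetric_symm (x : F) (a b : EuclideanSpace ℝ (Fin m)) :
    fiberMetric gF x a b = fiberMetric gF x b a := gF.symm x a b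

theorem fiberMetric_isNondegenerate (x : F) : IsNondegenerate (fiberMetric gF x) :=
  .of_pos fun v hv => gF.pos x v hv

/-- Smoothness of `gF` refers to bundle trivializations. The inverse tangent trivialization at `x`
is the derivative of the inverse chart, so the trivialized metric has the same components as
`chartForm`. -/
theorem differentiableAt_chartForm_fiberMetric (x : F) :
    DifferentiableAt ℝ (chartForm (𝓡 m) (fiberMetric gF) x) (extChartAt (𝓡 m) x x) := by
  have : IsManifold (𝓡 m) 1 F := .of_le (n := ∞) (by simp)
  have h := (contMDiffAt_hom_bundle _).1 (gF.contMDiff x) |>.2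
  refine differentiableAt_of_apply₂ fun u v => ?_
  have h2 : ContMDiffAt 𝓘(ℝ, EuclideanSpace ℝ (Fin m)) (𝓡 m) 1 (extChartAt (𝓡 m) x).symm
      (extChartAt (𝓡 m) x x) := by
    have := contMDiffWithinAt_extChartAt_symm_range (I := 𝓡 m) (n := 1) x
      (mem_extChartAt_target x)
    rwa [ModelWithCorners.range_eq_univ, contMDiffWithinAt_univ] at this
  have h3 := (ContMDiffAt.comp (extChartAt (𝓡 m) x x)
    (by rw [extChartAt_to_inv]; exact h.of_le (m := 1) (by simp)) h2)
  have h4 := h3.contDiffAt.differentiableAt (by simp)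
  have h5 := (h4.clm_apply (differentiableAt_const u)).clm_apply (differentiableAt_const v)
  refine h5.congr_of_eventuallyEq ?_
  filter_upwards [extChartAt_target_mem_nhds (I := 𝓡 m) x] with y hy
  have hs : (extChartAt (𝓡 m) x).symm y ∈ (chartAt (EuclideanSpace ℝ (Fin m)) x).source := by
    rw [← extChartAt_source (𝓡 m)]; exact (extChartAt (𝓡 m) x).map_target hy
  have h6 := TangentBundle.symmL_trivializationAt (I := 𝓡 m) hs
  rw [(extChartAt (𝓡 m) x).right_inv hy, ModelWithCorners.range_eq_univ, mfderivWithin_univ] at h6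
  have h7 := inCoordinates_apply_eq₂ (F₁ := EuclideanSpace ℝ (Fin m))
    (F₂ := EuclideanSpace ℝ (Fin m)) (F₃ := ℝ) (E₁ := (TangentSpace (𝓡 m) : F → Type _))
    (E₂ := (TangentSpace (𝓡 m) : F → Type _)) (E₃ := fun _ => ℝ) (x₀ := x)
    (ϕ := gF.inner ((extChartAt (𝓡 m) x).symm y)) (v := u) (w := v) hs hs (by simp)
  simp only [Function.comp_apply]
  refine Eq.trans ?_ h7.symm
  have h8 : ∀ w, (trivializationAt (EuclideanSpace ℝ (Fin m)) (TangentSpace (𝓡 m)) x).symm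
      ((extChartAt (𝓡 m) x).symm y) w =
      differential 𝓘(ℝ, EuclideanSpace ℝ (Fin m)) (𝓡 m) (extChartAt (𝓡 m) x).symm y w := by
    intro w
    rw [differential, ← h6]
    exact (Bundle.Trivialization.symmL_apply _ hs w).symm
  rw [h8, h8]
  simp
  rfl

end FiberMetric

/-! ### The Lorentzian product metric and its Christoffel symbols. -/

section LorentzMetric

theorem extChartAt_prodModel_self {m : ℕ} {F : Type*} [TopologicalSpace F]
    [ChartedSpace (EuclideanSpace ℝ (Fin m)) F] (x : ℝ × F) :
    extChartAt (prodModel m) x x = (x.1, extChartAt (𝓡 m) x.2 x.2) := by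
  rw [extChartAt_prod]; rfl

variable {m : ℕ} {F : Type*} [TopologicalSpace F] [ChartedSpace (EuclideanSpace ℝ (Fin m)) F]
  [IsManifold (𝓡 m) ∞ F] (gF : RiemannianMetricOn m F)

theorem lorentzMetric_apply (x : ℝ × F) (a b : ℝ × EuclideanSpace ℝ (Fin m)) :
    lorentzMetric gF x a b = -(a.1 * b.1) + fiberMetric gF x.2 a.2 b.2 := by
  simp only [lorentzMetric, pullback, differential, mfderiv_fst, mfderiv_snd]
  rfl

theorem lorentzMetric_symm (x : ℝ × F) (a b : ℝ × EuclideanSpace ℝ (Fin m)) :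
    lorentzMetric gF x a b = lorentzMetric gF x b a := by
  rw [lorentzMetric_apply, lorentzMetric_apply, fiberMetric_symm, mul_comm]

theorem lorentzMetric_isNondegenerate (x : ℝ × F) : IsNondegenerate (lorentzMetric gF x) := by
  intro u hu
  have h1 : u.1 = 0 := by simpa [lorentzMetric_apply] using hu (1, 0)
  have h2 : u.2 = 0 := fiberMetric_isNondegenerate gF x.2 _ fun w => by
    simpa [lorentzMetric_apply] using hu (0, w)
  exact Prod.ext h1 h2

theorem chartForm_lorentzMetric (x : ℝ × F) :
    ∀ᶠ z in 𝓝 (extChartAt (prodModel m) x x), ∀ a b,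
      chartForm (prodModel m) (lorentzMetric gF) x z a b = -(a.1 * b.1) + chartForm (𝓡 m) (fiberMetric gF) x.2 z.2 a.2 b.2 := by
  have : IsManifold (𝓡 m) 1 F := .of_le (n := ∞) (by simp)
  filter_upwards [extChartAt_target_mem_nhds (I := prodModel m) x] with z hz a b
  have hd := mdifferentiableAt_extChartAt_symm hz
  have hz2 : z.2 ∈ (extChartAt (𝓡 m) x.2).target := by
    rw [extChartAt_prod] at hz; exact hz.2
  have hd2 := mdifferentiableAt_extChartAt_symm hz2
  have e1 : Prod.fst ∘ (extChartAt (prodModel m) x).symm = Prod.fst := by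
    rw [extChartAt_prod]; rfl
  have e2 : Prod.snd ∘ (extChartAt (prodModel m) x).symm =
      (extChartAt (𝓡 m) x.2).symm ∘ Prod.snd := by
    rw [extChartAt_prod]; rfl
  have d1 : ∀ c, (differential 𝓘(ℝ, ℝ × EuclideanSpace ℝ (Fin m)) (prodModel m)
      (extChartAt (prodModel m) x).symm z c).1 = c.1 := by
    intro c
    have h1 := differential_comp (K := 𝓘(ℝ, ℝ)) (mdifferentiableAt_fst) hd
    rw [e1] at h1
    have := congrArg (fun L => L c) h1
    simp only [differential, mfderiv_fst, mfderiv_eq_fderiv, fderiv_fst] at this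
    exact this.symm
  have d2 : ∀ c, (differential 𝓘(ℝ, ℝ × EuclideanSpace ℝ (Fin m)) (prodModel m)
      (extChartAt (prodModel m) x).symm z c).2 =
      differential 𝓘(ℝ, EuclideanSpace ℝ (Fin m)) (𝓡 m) (extChartAt (𝓡 m) x.2).symm z.2 c.2 := by
    intro c
    have h1 := differential_comp (K := 𝓡 m) (mdifferentiableAt_snd) hd
    rw [e2, differential_comp (J := 𝓘(ℝ, EuclideanSpace ℝ (Fin m))) hd2
      differentiableAt_snd.mdifferentiableAt] at h1
    have := congrArg (fun L => L c) h1
    simp only [differential, mfderiv_snd, mfderiv_eq_fderiv, fderiv_snd] at this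
    exact this.symm
  have e3 : ((extChartAt (prodModel m) x).symm z).2 = (extChartAt (𝓡 m) x.2).symm z.2 :=
    congrFun e2 z
  simp only [chartForm, pullback, ContinuousLinearMap.bilinearComp_apply, lorentzMetric_apply,
    d1, d2, e3]

theorem hasFDerivAt_chartForm_lorentzMetric_apply (x : ℝ × F)
    (a b : ℝ × EuclideanSpace ℝ (Fin m)) :
    HasFDerivAt (fun z => chartForm (prodModel m) (lorentzMetric gF) x z a b)
      ((((fderiv ℝ (chartForm (𝓡 m) (fiberMetric gF) x.2) (extChartAt (𝓡 m) x.2 x.2)).flip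
        a.2).flip b.2).comp (.snd ℝ ℝ _)) (extChartAt (prodModel m) x x) := by
  have h1 : HasFDerivAt (chartForm (𝓡 m) (fiberMetric gF) x.2)
      (fderiv ℝ (chartForm (𝓡 m) (fiberMetric gF) x.2) (extChartAt (𝓡 m) x.2 x.2))
      (extChartAt (prodModel m) x x).2 := by
    rw [extChartAt_prodModel_self]
    exact (differentiableAt_chartForm_fiberMetric gF x.2).hasFDerivAt
  have h2 := (((h1.clm_apply (hasFDerivAt_const a.2 _)).clm_apply (hasFDerivAt_const b.2 _)).comp
    _ hasFDerivAt_snd).const_add (-(a.1 * b.1))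
  refine HasFDerivAt.congr_of_eventuallyEq (f := fun z => -(a.1 * b.1) +
    chartForm (𝓡 m) (fiberMetric gF) x.2 z.2 a.2 b.2) ?_ ?_
  · convert! h2 using 1
    ext c <;> simp
  · filter_upwards [chartForm_lorentzMetric gF x] with z hz using hz a b

theorem differentiableAt_chartForm_lorentzMetric (x : ℝ × F) :
    DifferentiableAt ℝ (chartForm (prodModel m) (lorentzMetric gF) x)
      (extChartAt (prodModel m) x x) :=
  differentiableAt_of_apply₂ fun a b =>
    (hasFDerivAt_chartForm_lorentzMetric_apply gF x a b).differentiableAt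

theorem fderiv_chartForm_lorentzMetric (x : ℝ × F) (c a b : ℝ × EuclideanSpace ℝ (Fin m)) :
    fderiv ℝ (chartForm (prodModel m) (lorentzMetric gF) x) (extChartAt (prodModel m) x x) c a b =
      fderiv ℝ (chartForm (𝓡 m) (fiberMetric gF) x.2) (extChartAt (𝓡 m) x.2 x.2) c.2 a.2 b.2 := by
  have h1 := ((differentiableAt_chartForm_lorentzMetric gF x).hasFDerivAt.clm_apply
    (hasFDerivAt_const a _)).clm_apply (hasFDerivAt_const b _)
  have h2 := h1.unique (hasFDerivAt_chartForm_lorentzMetric_apply gF x a b)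
  simpa using congrArg (fun L : (ℝ × EuclideanSpace ℝ (Fin m)) →L[ℝ] ℝ => L c) h2

/-- The `dt²` part has constant coefficients, so only derivatives of the fiber metric enter the
Koszul formula; nondegeneracy then determines the vector. -/
theorem christoffel_lorentzMetric (x : ℝ × F) (a b : ℝ × EuclideanSpace ℝ (Fin m)) :
    christoffel (prodModel m) (lorentzMetric gF) x (extChartAt (prodModel m) x x) a b =
      (0, christoffel (𝓡 m) (fiberMetric gF) x.2 (extChartAt (𝓡 m) x.2 x.2) a.2 b.2) := by
  have : IsManifold (𝓡 m) 1 F := .of_le (n := ∞) (by simp)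
  refine christoffel_eq (lorentzMetric_isNondegenerate gF x) fun w => ?_
  rw [lorentzMetric_apply, fderiv_chartForm_lorentzMetric, fderiv_chartForm_lorentzMetric,
    fderiv_chartForm_lorentzMetric, ← koszul_christoffel (fiberMetric_isNondegenerate gF x.2)]
  simp

end LorentzMetric

theorem fderiv_fderiv_clm_comp {V W U : Type*} [NormedAddCommGroup V] [NormedSpace ℝ V]
    [NormedAddCommGroup W] [NormedSpace ℝ W] [NormedAddCommGroup U] [NormedSpace ℝ U]
    (L : W →L[ℝ] U) {f : V → W} {y : V} (hf : ContDiffAt ℝ 2 f y) (u v : V) :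
    fderiv ℝ (fderiv ℝ fun z => L (f z)) y u v = L (fderiv ℝ (fderiv ℝ f) y u v) := by
  have hd : ∀ᶠ z in 𝓝 y, DifferentiableAt ℝ f z :=
    (hf.eventually (by simp)).mono fun z hz => hz.differentiableAt (by simp)
  have h1 : fderiv ℝ (fun z => L (f z)) =ᶠ[𝓝 y]
      fun z => ContinuousLinearMap.compL ℝ V W U L (fderiv ℝ f z) := by
    filter_upwards [hd] with z hz
    exact (L.hasFDerivAt.comp z hz.hasFDerivAt).fderiv
  have h2 : DifferentiableAt ℝ (fderiv ℝ f) y :=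
    (hf.fderiv_right (m := 1) (by norm_num)).differentiableAt (by norm_num)
  have h3 := (((ContinuousLinearMap.compL ℝ V W U L).hasFDerivAt).comp y h2.hasFDerivAt).fderiv
  rw [h1.fderiv_eq]
  exact congrArg (fun A : V →L[ℝ] V →L[ℝ] U => A u v) h3

/-! ### Components of a map into the product, and elementary rules for the Laplacian. -/

section Coordinates

variable {m k : ℕ} {F : Type*} [TopologicalSpace F] [ChartedSpace (EuclideanSpace ℝ (Fin m)) F]
  {M : Type*} [TopologicalSpace M] [ChartedSpace (EuclideanSpace ℝ (Fin k)) M]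
  {ψ : M → ℝ × F}

theorem writtenInExtChartAt_prodModel (ψ : M → ℝ × F) (p : M) :
    writtenInExtChartAt (𝓡 k) (prodModel m) p ψ = fun y =>
      ((ψ ((extChartAt (𝓡 k) p).symm y)).1,
        writtenInExtChartAt (𝓡 k) (𝓡 m) p (fun q => (ψ q).2) y) := by
  rw [writtenInExtChartAt, extChartAt_prod]
  rfl

theorem differential_prod (hψ : ContMDiff (𝓡 k) (prodModel m) ∞ ψ) (p : M)
    (w : EuclideanSpace ℝ (Fin k)) :
    differential (𝓡 k) (prodModel m) ψ p w =
      (fderiv ℝ (fun y => (ψ ((extChartAt (𝓡 k) p).symm y)).1) (extChartAt (𝓡 k) p p) w,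
        differential (𝓡 k) (𝓡 m) (fun q => (ψ q).2) p w) := by
  have hd := hψ.mdifferentiable (by simp) p
  have h1 := differential_comp (K := 𝓘(ℝ, ℝ)) mdifferentiableAt_fst hd
  have h2 := differential_comp (K := 𝓡 m) mdifferentiableAt_snd hd
  rw [differential_of_boundaryless (mdifferentiableAt_fst.comp p hd)] at h1
  simp only [differential, mfderiv_fst, mfderiv_snd] at h1 h2
  ext1
  · exact (congrArg (fun L => L w) h1).symm
  · exact (congrArg (fun L => L w) h2).symm

theorem laplacian_neg (g : FormField (𝓡 k) M) (u : M → ℝ) (p : M) :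
    laplacian k g (fun q => -u q) p = -laplacian k g u p := by
  have h1 : ∀ y, fderiv ℝ ((fun q => -u q) ∘ (extChartAt (𝓡 k) p).symm) y =
      -fderiv ℝ (u ∘ (extChartAt (𝓡 k) p).symm) y := fun y => fderiv_fun_neg
  have h2 : ∀ v w, hessian (𝓡 k) g (fun q => -u q) p v w = -hessian (𝓡 k) g u p v w := by
    intro v w
    simp only [hessian, funext h1, fderiv_fun_neg, neg_apply]
    ring
  simp [laplacian, metricTrace, h2]

theorem laplacian_const (g : FormField (𝓡 k) M) (c : ℝ) (p : M) :
    laplacian k g (fun _ => c) p = 0 := by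
  have h1 : (fun _ : M => c) ∘ (extChartAt (𝓡 k) p).symm = fun _ => c := rfl
  have h2 : ∀ v w, hessian (𝓡 k) g (fun _ => c) p v w = 0 := by
    intro v w
    simp only [hessian, h1]
    simp
  simp [laplacian, metricTrace, h2]

end Coordinates

/-! ### Mean curvature and the Laplacian of the height. -/

section Immersion

variable {m k : ℕ} {F : Type*} [TopologicalSpace F] [ChartedSpace (EuclideanSpace ℝ (Fin m)) F]
  [IsManifold (𝓡 m) ∞ F] {gF : RiemannianMetricOn m F}
  {M : Type*} [TopologicalSpace M] [ChartedSpace (EuclideanSpace ℝ (Fin k)) M]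
  {ψ : M → ℝ × F}

theorem covDerivAlong_lorentzMetric (hψ : ContMDiff (𝓡 k) (prodModel m) ∞ ψ) (p : M)
    (u v : EuclideanSpace ℝ (Fin k)) :
    covDerivAlong (𝓡 k) (prodModel m) (lorentzMetric gF) ψ p u v =
      (fderiv ℝ (fderiv ℝ fun y => (ψ ((extChartAt (𝓡 k) p).symm y)).1) (extChartAt (𝓡 k) p p) u v,
        covDerivAlong (𝓡 k) (𝓡 m) (fiberMetric gF) (fun q => (ψ q).2) p u v) := by
  have hc : ContDiffAt ℝ 2 _ _ :=
    contDiffAt_writtenInExtChartAt ((contMDiff_infty.1 hψ 2) p)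
  have hbase : writtenInExtChartAt (𝓡 k) (prodModel m) p ψ (extChartAt (𝓡 k) p p) =
      extChartAt (prodModel m) (ψ p) (ψ p) := by simp [writtenInExtChartAt]
  have hbase2 : writtenInExtChartAt (𝓡 k) (𝓡 m) p (fun q => (ψ q).2) (extChartAt (𝓡 k) p p) =
      extChartAt (𝓡 m) (ψ p).2 (ψ p).2 := by simp [writtenInExtChartAt]
  have h1 := fderiv_fderiv_clm_comp (.fst ℝ ℝ (EuclideanSpace ℝ (Fin m))) hc u v
  have h2 := fderiv_fderiv_clm_comp (.snd ℝ ℝ (EuclideanSpace ℝ (Fin m))) hc u v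
  have h3 : ∀ w, (fderiv ℝ (writtenInExtChartAt (𝓡 k) (prodModel m) p ψ)
      (extChartAt (𝓡 k) p p) w).2 =
      fderiv ℝ (writtenInExtChartAt (𝓡 k) (𝓡 m) p fun q => (ψ q).2) (extChartAt (𝓡 k) p p) w := by
    intro w
    have := ((ContinuousLinearMap.snd ℝ ℝ (EuclideanSpace ℝ (Fin m))).hasFDerivAt.comp _
      (hc.differentiableAt (by simp)).hasFDerivAt).fderiv
    rw [writtenInExtChartAt_prodModel] at this ⊢
    exact congrArg (fun L => L w) this.symm
  have h4 : ∀ z, (writtenInExtChartAt (𝓡 k) (prodModel m) p ψ z).1 =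
      (ψ ((extChartAt (𝓡 k) p).symm z)).1 := fun z => by rw [writtenInExtChartAt_prodModel]
  have h5 : ∀ z, (writtenInExtChartAt (𝓡 k) (prodModel m) p ψ z).2 =
      writtenInExtChartAt (𝓡 k) (𝓡 m) p (fun q => (ψ q).2) z := fun z => by
    rw [writtenInExtChartAt_prodModel]
  simp only [ContinuousLinearMap.coe_fst', ContinuousLinearMap.coe_snd', h4, h5] at h1 h2
  simp only [covDerivAlong, hbase, christoffel_lorentzMetric, h3, hbase2]
  ext1
  · rw [Prod.fst_add, ← h1, add_zero]
  · rw [Prod.snd_add, ← h2]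

/-- Inside a slice, the slice component of the mean curvature vector is the mean curvature vector
of the immersion into the slice. -/
theorem meanCurvatureVector_snd_of_height_const (hψ : ContMDiff (𝓡 k) (prodModel m) ∞ ψ)
    {c : ℝ} (hc : ∀ p, (ψ p).1 = c) (p : M) : (meanCurvatureVector k gF ψ p).2 =
      meanCurvature k (𝓡 m) (fiberMetric gF) (fun q => (ψ q).2) p := by
  -- With no time component in `dψ`, the term `-dt²` drops out of the induced metric and of the
  -- pairings defining tangential parts.
  have hd : ∀ w, differential (𝓡 k) (prodModel m) ψ p w =
      (0, differential (𝓡 k) (𝓡 m) (fun q => (ψ q).2) p w) := fun w => by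
    rw [differential_prod hψ]
    simp [hc]
  have hpull : pullback (𝓡 k) (prodModel m) ψ (lorentzMetric gF) p =
      pullback (𝓡 k) (𝓡 m) (fun q => (ψ q).2) (fiberMetric gF) p := by
    ext u v
    simp [pullback, hd, lorentzMetric_apply]
  have htan : ∀ a, tangentPart (𝓡 k) (prodModel m) (lorentzMetric gF) ψ p a =
      tangentPart (𝓡 k) (𝓡 m) (fiberMetric gF) (fun q => (ψ q).2) p a.2 := fun a => by
    rw [tangentPart, tangentPart, hpull]
    congr 1
    ext w
    simp [hd, lorentzMetric_apply]
  have hII : ∀ u v, (secondFundamentalForm (𝓡 k) (prodModel m) (lorentzMetric gF) ψ p u v).2 =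
      secondFundamentalForm (𝓡 k) (𝓡 m) (fiberMetric gF) (fun q => (ψ q).2) p u v := fun u v => by
    simp [secondFundamentalForm, normalPart, htan, hd, covDerivAlong_lorentzMetric hψ]
  have h := map_metricTrace (pullback (𝓡 k) (prodModel m) ψ (lorentzMetric gF) p)
    (secondFundamentalForm (𝓡 k) (prodModel m) (lorentzMetric gF) ψ p)
    (LinearMap.snd ℝ ℝ (EuclideanSpace ℝ (Fin m)))
  simp only [LinearMap.snd_apply, hII] at h
  rw [meanCurvatureVector, meanCurvature, meanCurvature, Prod.smul_snd, h, hpull]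

/-- On a parabolic submanifold, a height function which is bounded on one side and whose Laplacian
has the corresponding sign is constant. -/
theorem height_const (hψ : IsSpacelikeImmersion k gF ψ)
    (hpar : IsParabolic k (inducedMetric k gF ψ))
    (h : ((∀ p, laplacian k (inducedMetric k gF ψ) (fun q => (ψ q).1) p ≤ 0) ∧
        BoundedAwayFromPastInfinity ψ) ∨
      ((∀ p, 0 ≤ laplacian k (inducedMetric k gF ψ) (fun q => (ψ q).1) p) ∧
        BoundedAwayFromFutureInfinity ψ)) : ∃ c, ∀ p, (ψ p).1 = c := by
  have hs : ContMDiff (𝓡 k) 𝓘(ℝ, ℝ) 2 fun q => (ψ q).1 :=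
    contMDiff_fst.comp (contMDiff_infty.1 hψ.smooth 2)
  rcases h with ⟨hl, a, ha⟩ | ⟨hl, b, hb⟩
  · exact hpar _ hs hl ⟨a, by rintro _ ⟨p, rfl⟩; exact ha p⟩
  · obtain ⟨c, hc⟩ := hpar (fun q => -(ψ q).1) hs.neg
      (fun p => by rw [laplacian_neg]; linarith [hl p])
      ⟨-b, by rintro _ ⟨p, rfl⟩; exact neg_le_neg (hb p)⟩
    exact ⟨-c, fun p => by rw [← hc p, neg_neg]⟩

variable [IsManifold (𝓡 k) ∞ M]

/-- The time component of the second fundamental form is minus the Hessian of the height. -/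
theorem secondFundamentalForm_fst (hψ : IsSpacelikeImmersion k gF ψ) (p : M)
    (u v : EuclideanSpace ℝ (Fin k)) :
    (secondFundamentalForm (𝓡 k) (prodModel m) (lorentzMetric gF) ψ p u v).1 =
      -hessian (𝓡 k) (inducedMetric k gF ψ) (fun q => (ψ q).1) p u v := by
  have : IsManifold (𝓡 m) 1 F := .of_le (n := ∞) (by simp)
  have : IsManifold (𝓡 k) 1 M := .of_le (n := ∞) (by simp)
  rw [secondFundamentalForm, normalPart, tangentPart_covDerivAlong
    (contMDiff_infty.1 hψ.smooth 2) p (lorentzMetric_symm gF _)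
    (lorentzMetric_isNondegenerate gF _) (differentiableAt_chartForm_lorentzMetric gF _)
    (.of_pos (hψ.posDef p)), covDerivAlong_lorentzMetric hψ.smooth, differential_prod hψ.smooth]
  rfl

/-- Trace of the Hessian identity `secondFundamentalForm_fst`; the factor `k` undoes the
normalization of the mean curvature vector. -/
theorem laplacian_height (hk : 1 ≤ k) (hψ : IsSpacelikeImmersion k gF ψ) (p : M) :
    laplacian k (inducedMetric k gF ψ) (fun q => (ψ q).1) p =
      -(k * (meanCurvatureVector k gF ψ p).1) := by
  have hk' : (k : ℝ) ≠ 0 := by positivity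
  have h := map_metricTrace (inducedMetric k gF ψ p)
    (secondFundamentalForm (𝓡 k) (prodModel m) (lorentzMetric gF) ψ p)
    (LinearMap.fst ℝ ℝ (EuclideanSpace ℝ (Fin m)))
  simp only [LinearMap.fst_apply, secondFundamentalForm_fst hψ] at h
  have h2 : metricTrace (inducedMetric k gF ψ p) (fun u v =>
      -hessian (𝓡 k) (inducedMetric k gF ψ) (fun q => (ψ q).1) p u v) =
      -laplacian k (inducedMetric k gF ψ) (fun q => (ψ q).1) p := by
    simp [metricTrace, laplacian]
  rw [h2] at h
  rw [meanCurvatureVector, meanCurvature, Prod.smul_fst, smul_eq_mul]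
  rw [inducedMetric] at h
  rw [h]
  field_simp
  simp [inducedMetric]

theorem meanCurvatureVector_fst_of_height_const (hk : 1 ≤ k) (hψ : IsSpacelikeImmersion k gF ψ)
    {c : ℝ} (hc : ∀ p, (ψ p).1 = c) (p : M) : (meanCurvatureVector k gF ψ p).1 = 0 := by
  have h := laplacian_height hk hψ p
  rw [funext hc, laplacian_const] at h
  have hk' : (k : ℝ) ≠ 0 := by positivity
  simpa [hk'] using h.symm

end Immersion

end LorentzProduct

/-! ### The main theorem. -/

open LorentzProduct in
theorem corollary4p5 {m k : ℕ} (hm : 2 ≤ m) (hk : 1 ≤ k)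
    {F : Type*} [TopologicalSpace F] [T2Space F] [SecondCountableTopology F] [ConnectedSpace F]
    [ChartedSpace (EuclideanSpace ℝ (Fin m)) F] [IsManifold (𝓡 m) ∞ F]
    (gF : RiemannianMetricOn m F)
    {M : Type*} [TopologicalSpace M] [T2Space M] [SecondCountableTopology M] [ConnectedSpace M]
    [ChartedSpace (EuclideanSpace ℝ (Fin k)) M] [IsManifold (𝓡 k) ∞ M]
    (ψ : M → ℝ × F) (hψ : IsSpacelikeImmersion k gF ψ)
    (hpar : IsParabolic k (inducedMetric k gF ψ)) :
    (InSlab ψ → ¬ IsWeaklyTrapped k gF ψ) ∧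
      ((IsExtremal k gF ψ ∧ (BoundedAwayFromFutureInfinity ψ ∨ BoundedAwayFromPastInfinity ψ)) ↔
        IsMinimalInSlice k gF ψ) := by
  have hk' : (0 : ℝ) < k := by positivity
  have htime : ∀ p (v : ℝ × EuclideanSpace ℝ (Fin m)),
      lorentzMetric gF (ψ p) v (timeVector m) = -v.1 := fun p v => by
    simp [lorentzMetric_apply, timeVector]
  refine ⟨?_, ?_, ?_⟩
  · rintro ⟨a, b, hab⟩ htrap
    obtain ⟨p⟩ : Nonempty M := inferInstance
    rcases htrap with h | h
    -- Future case: `Δτ < 0`, and the lower wall of the slab bounds the superharmonic `τ` from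
    -- below.
    · have hpos : ∀ q, 0 < (meanCurvatureVector k gF ψ q).1 := fun q => by
        have := (h q).2
        rw [htime] at this
        linarith
      obtain ⟨c, hc⟩ := height_const hψ hpar (.inl ⟨fun q => by
        rw [laplacian_height hk hψ]
        linarith [mul_pos hk' (hpos q)], a, fun q => (hab q).1⟩)
      exact (hpos p).ne' (meanCurvatureVector_fst_of_height_const hk hψ hc p)
    -- Past case: `Δτ > 0`, and the upper wall is the relevant bound.
    · have hneg : ∀ q, (meanCurvatureVector k gF ψ q).1 < 0 := fun q => by
        have := (h q).2
        rw [htime] at this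
        linarith
      obtain ⟨c, hc⟩ := height_const hψ hpar (.inr ⟨fun q => by
        rw [laplacian_height hk hψ]
        linarith [mul_neg_of_pos_of_neg hk' (hneg q)], b, fun q => (hab q).2⟩)
      exact (hneg p).ne (meanCurvatureVector_fst_of_height_const hk hψ hc p)
  · rintro ⟨hext, hbd⟩
    have hlap : ∀ p, laplacian k (inducedMetric k gF ψ) (fun q => (ψ q).1) p = 0 := fun p => by
      rw [laplacian_height hk hψ, hext p]
      simp
    -- A harmonic height is both super- and subharmonic, so either one-sided bound suffices.
    obtain ⟨c, hc⟩ := height_const hψ hpar (hbd.symm.imp (fun h => ⟨fun p => (hlap p).le, h⟩)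
      fun h => ⟨fun p => (hlap p).ge, h⟩)
    exact ⟨c, hc, fun p => by
      rw [← meanCurvatureVector_snd_of_height_const hψ.smooth hc, hext p, Prod.snd_zero]⟩
  · rintro ⟨c, hc, hmin⟩
    exact ⟨fun p => Prod.ext (meanCurvatureVector_fst_of_height_const hk hψ hc p)
      ((meanCurvatureVector_snd_of_height_const hψ.smooth hc p).trans (hmin p)),
      .inl ⟨c, fun p => (hc p).le⟩⟩
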